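/- Fix $d\ge 0$. A \emph{labelled Delone set} is the graph $T\subset\mathbb R^d\times X$ of a map from a Delone subset of $\mathbb R^d$ (uniformly discrete and relatively dense) to a compact metric space $X$ of labels; $T-x$ is its translate by $-x$, the labels being carried along. Labelled Delone sets with labels in $X$ carry the usual local topology: $T$ and $T'$ are close if, on a large ball around the origin, each labelled point of either one has a labelled point of the other nearby, both in position and in label. A \emph{tiling space} is a hull $\Omega=\overline{\{T-x : x\in\mathbb R^d\}}$ of a labelled Delone set $T$, with its translation action of $\mathbb R^d$, which is minimal (all orbits are dense in $\Omega$) and aperiodic ($T-x=T$ with $T\in\Omega$ implies $x=0$); finite local complexity is not assumed, and different tiling spaces may have different label spaces. (A tiling is regarded as the labelled Delone set of its punctures, labelled by the prototiles and the labels of the tiles.) The space $\Omega$ is \emph{uniquely ergodic} if it has exactly one translation-invariant Borel probability measure. Let $\Omega,\Omega'$ be tiling spaces of dimension $d$. - They are \emph{orbit equivalent} if there is a homeomorphism $h:\Omega\to\Omega'$ that maps each $\mathbb R^d$-orbit of $\Omega$ onto an $\mathbb R^d$-orbit of $\Omega'$. - They are \emph{topologically conjugate} if there is a homeomorphism $h:\Omega\to\Omega'$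 with $h(T-x)=h(T)-x$ for all $T\in\Omega$, $x\in\mathbb R^d$. - $\Omega'$ is obtained from $\Omega$ by a \emph{continuous shape change} if there are a homeomorphism $h:\Omega\to\Omega'$ and a continuous $1$-cocycle $\alpha:\Omega\times\mathbb R^d\to\mathbb R^d$, i.e. $\alpha(T,x)+\alpha(T-x,y)=\alpha(T,x+y)$, such that for every $T\in\Omega$ the map $\varphi=\alpha(T,\cdot)$ is a homeomorphism of $\mathbb R^d$, $h(T-x)=h(T)-\varphi(x)$ for all $x\in\mathbb R^d$, the points of $h(T)$ are exactly the images $\varphi(x)$ of the points $x$ of $T$, and the label of $\varphi(x)$ in $h(T)$ determines the label of $x$ in $T$, by a rule that depends neither on $T$ nor on $x$. **Corollary.** Within the class of uniquely ergodic tiling spaces of dimension $d$, with or without finite local complexity, the relation ``to be orbit equivalent'' is the equivalence relation generated by topological conjugacies and continuous shape changes. That is, two uniquely ergodic tiling spaces $\Omega$ and $\Omega'$ are orbit equivalent if and only if there is a finite chain $\Omega=\Omega_0,\Omega_1,\dots,\Omega_n=\Omega'$ of uniquely ergodic tiling spaces such that, for each $i<n$, one of $\Omega_i,\Omega_{i+1}$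 is topologically conjugate to, or a continuous shape change of, the other. -/

import Mathlib

open Set Filter Topology MeasureTheory
open scoped Uniformity

universe u

namespace TilingShape

/-- The Euclidean space `ℝᵈ`. -/
abbrev E (d : ℕ) : Type := EuclideanSpace ℝ (Fin d)

/-- A labelled Delone set of `ℝᵈ`: the graph of a map from a Delone set to the label space `X`. -/
@[ext]
structure LabeledDelone (d : ℕ) (X : Type u) where
  graph : Set (E d × X)
  functional : ∀ p ∈ graph, ∀ q ∈ graph, p.1 = q.1 → p.2 = q.2
  isDelone : ∃ D : Delone.DeloneSet (E d), D.carrier = Prod.fst '' graph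

namespace LabeledDelone

variable {d : ℕ} {X : Type u}

/-- The underlying (unlabelled) Delone set. -/
def points (T : LabeledDelone d X) : Set (E d) := Prod.fst '' T.graph

/-- The translate `T + v`: every point moves by `v` and keeps its label. -/
def translate (v : E d) (T : LabeledDelone d X) : LabeledDelone d X where
  graph := (fun p : E d × X => (v + p.1, p.2)) '' T.graph
  functional := by
    rintro _ ⟨p, hp, rfl⟩ _ ⟨q, hq, rfl⟩ h
    exact T.functional p hp q hq (add_left_cancel h)
  isDelone := by
    obtain ⟨D, hD⟩ := T.isDelone
    refine ⟨Delone.DeloneSet.mapIsometry (IsometryEquiv.addLeft v) D, ?_⟩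
    have h1 : (Delone.DeloneSet.mapIsometry (IsometryEquiv.addLeft v) D).carrier
        = (fun x => v + x) '' D.carrier := rfl
    rw [h1, hD, image_image, image_image]

/-- The action of `ℝᵈ` on labelled Delone sets by translation; `T - x` is `(-x) +ᵥ T`. -/
instance : AddAction (E d) (LabeledDelone d X) where
  vadd := translate
  zero_vadd T := by
    apply LabeledDelone.ext
    change (fun p : E d × X => ((0 : E d) + p.1, p.2)) '' T.graph = T.graph
    simp
  add_vadd v w T := by
    apply LabeledDelone.ext
    change (fun p : E d × X => ((v + w) + p.1, p.2)) '' T.graph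
      = (fun p : E d × X => (v + p.1, p.2)) '' ((fun p : E d × X => (w + p.1, p.2)) '' T.graph)
    rw [image_image]
    simp only [add_assoc]

theorem mem_vadd {v : E d} {T : LabeledDelone d X} {p : E d × X} :
    p ∈ (v +ᵥ T).graph ↔ (p.1 - v, p.2) ∈ T.graph := by
  change p ∈ (fun p : E d × X => (v + p.1, p.2)) '' T.graph ↔ _
  constructor
  · rintro ⟨q, hq, rfl⟩
    simpa using hq
  · intro h
    exact ⟨_, h, by simp⟩

variable [MetricSpace X]

/-- `T` and `T'` are `ε`-near if every labelled point of either one inside the ball `B(0, 1/ε)` has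
a labelled point of the other one within `ε`, both in position and in label. (`dist` is the maximum
of the two distances. On Delone sets with a common packing radius `r > 2 ε` the corresponding point
is unique, so that this is a one-to-one correspondence.) -/
def near (d : ℕ) (X : Type u) [MetricSpace X] (ε : ℝ) :
    Set (LabeledDelone d X × LabeledDelone d X) :=
  {P | (∀ p ∈ P.1.graph, ‖p.1‖ < ε⁻¹ → ∃ q ∈ P.2.graph, dist p q < ε) ∧
    (∀ q ∈ P.2.graph, ‖q.1‖ < ε⁻¹ → ∃ p ∈ P.1.graph, dist p q < ε)}

theorem near_mono {ε δ : ℝ} (hε : 0 < ε) (h : ε ≤ δ) : near d X ε ⊆ near d X δ := by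
  rintro ⟨S, T⟩ ⟨h1, h2⟩
  have hinv : δ⁻¹ ≤ ε⁻¹ := inv_anti₀ hε h
  refine ⟨fun p hp hn => ?_, fun q hq hn => ?_⟩
  · obtain ⟨q, hq, hd⟩ := h1 p hp (hn.trans_le hinv)
    exact ⟨q, hq, hd.trans_le h⟩
  · obtain ⟨p, hp, hd⟩ := h2 q hq (hn.trans_le hinv)
    exact ⟨p, hp, hd.trans_le h⟩

theorem near_symm {ε : ℝ} {S T : LabeledDelone d X} (h : (S, T) ∈ near d X ε) :
    (T, S) ∈ near d X ε :=
  ⟨fun p hp hn => by simpa [dist_comm] using h.2 p hp hn,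
    fun p hp hn => by simpa [dist_comm] using h.1 p hp hn⟩

theorem exists_near_scale {ε c : ℝ} (hε : 0 < ε) (hc : 0 ≤ c) :
    ∃ δ, 0 < δ ∧ δ ≤ ε / 2 ∧ ε⁻¹ + c + δ ≤ δ⁻¹ := by
  have hpos : 0 < ε⁻¹ + c + 1 := by positivity
  refine ⟨min (ε / 2) (min 1 (ε⁻¹ + c + 1)⁻¹), by positivity, min_le_left _ _, ?_⟩
  have h1 : min (ε / 2) (min 1 (ε⁻¹ + c + 1)⁻¹) ≤ 1 :=
    (min_le_right _ _).trans (min_le_left _ _)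
  have h2 : min (ε / 2) (min 1 (ε⁻¹ + c + 1)⁻¹) ≤ (ε⁻¹ + c + 1)⁻¹ :=
    (min_le_right _ _).trans (min_le_right _ _)
  have h3 := inv_anti₀ (show 0 < min (ε / 2) (min 1 (ε⁻¹ + c + 1)⁻¹) by positivity) h2
  rw [inv_inv] at h3
  linarith

theorem near_comp {ε δ : ℝ} (h1 : δ ≤ ε / 2) (h2 : ε⁻¹ + δ ≤ δ⁻¹) (hδ : 0 < δ)
    {S T U : LabeledDelone d X} (hST : (S, T) ∈ near d X δ) (hTU : (T, U) ∈ near d X δ) :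
    (S, U) ∈ near d X ε := by
  have key : ∀ {S T U : LabeledDelone d X}, (S, T) ∈ near d X δ → (T, U) ∈ near d X δ →
      ∀ p ∈ S.graph, ‖p.1‖ < ε⁻¹ → ∃ q ∈ U.graph, dist p q < ε := by
    intro S T U hST hTU p hp hn
    obtain ⟨q, hq, hd⟩ := hST.1 p hp (by linarith)
    have hq' : ‖q.1‖ < δ⁻¹ := by
      have h3 : ‖q.1‖ ≤ ‖p.1‖ + dist p.1 q.1 := by
        rw [dist_eq_norm, norm_sub_rev]
        exact norm_le_norm_add_norm_sub' _ _
      have h4 : dist p.1 q.1 ≤ dist p q := le_max_left _ _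
      linarith
    obtain ⟨r, hr, hd'⟩ := hTU.1 q hq hq'
    exact ⟨r, hr, by linarith [dist_triangle p q r]⟩
  refine ⟨key hST hTU, fun q hq hn => ?_⟩
  obtain ⟨p, hp, hd⟩ := key (near_symm hTU) (near_symm hST) q hq hn
  exact ⟨p, hp, by rwa [dist_comm]⟩

/-- The basis of entourages `near d X ε`, `ε > 0`. -/
def nearBasis (d : ℕ) (X : Type u) [MetricSpace X] :
    FilterBasis (LabeledDelone d X × LabeledDelone d X) where
  sets := {V | ∃ ε : ℝ, 0 < ε ∧ V = near d X ε}
  nonempty := ⟨_, 1, one_pos, rfl⟩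
  inter_sets := by
    rintro _ _ ⟨ε, hε, rfl⟩ ⟨δ, hδ, rfl⟩
    exact ⟨_, ⟨min ε δ, lt_min hε hδ, rfl⟩, subset_inter
      (near_mono (lt_min hε hδ) (min_le_left _ _)) (near_mono (lt_min hε hδ) (min_le_right _ _))⟩

/-- The (uniform, hence topological) structure on labelled Delone sets: `T` and `T'` are close if
on a large ball around the origin their labelled points nearly coincide. -/
instance : UniformSpace (LabeledDelone d X) :=
  UniformSpace.ofCore <| UniformSpace.Core.mkOfBasis (nearBasis d X)
    (by
      rintro _ ⟨ε, hε, rfl⟩ T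
      exact ⟨fun p hp _ => ⟨p, hp, by simpa using hε⟩, fun p hp _ => ⟨p, hp, by simpa using hε⟩⟩)
    (by
      rintro _ ⟨ε, hε, rfl⟩
      exact ⟨_, ⟨ε, hε, rfl⟩, fun P hP => near_symm hP⟩)
    (by
      rintro _ ⟨ε, hε, rfl⟩
      obtain ⟨δ, hδ, h1, h2⟩ := exists_near_scale hε le_rfl
      refine ⟨_, ⟨δ, hδ, rfl⟩, ?_⟩
      rintro ⟨S, U⟩ ⟨T, hST, hTU⟩
      exact near_comp h1 (by linarith) hδ hST hTU)

theorem hasBasis_uniformity :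
    (𝓤 (LabeledDelone d X)).HasBasis (fun ε : ℝ => 0 < ε) (near d X) := by
  refine ⟨fun t => ?_⟩
  change t ∈ (nearBasis d X).filter ↔ _
  rw [FilterBasis.mem_filter_iff]
  constructor
  · rintro ⟨_, ⟨ε, hε, rfl⟩, h⟩
    exact ⟨ε, hε, h⟩
  · rintro ⟨ε, hε, h⟩
    exact ⟨_, ⟨ε, hε, rfl⟩, h⟩

theorem near_vadd {ε δ : ℝ} {v : E d} (h1 : δ ≤ ε) (h2 : ε⁻¹ + ‖v‖ ≤ δ⁻¹)
    {S T : LabeledDelone d X} (h : (S, T) ∈ near d X δ) :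
    (v +ᵥ S, v +ᵥ T) ∈ near d X ε := by
  have key : ∀ {S T : LabeledDelone d X}, (S, T) ∈ near d X δ →
      ∀ p ∈ (v +ᵥ S).graph, ‖p.1‖ < ε⁻¹ → ∃ q ∈ (v +ᵥ T).graph, dist p q < ε := by
    intro S T h p hp hn
    obtain ⟨q, hq, hd⟩ := h.1 _ (mem_vadd.1 hp) (by
      have h3 : ‖p.1 - v‖ ≤ ‖p.1‖ + ‖v‖ := norm_sub_le _ _
      linarith)
    refine ⟨(q.1 + v, q.2), mem_vadd.2 (by simpa using hq), ?_⟩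
    have h4 : dist p (q.1 + v, q.2) = dist ((p.1 - v, p.2) : E d × X) q := by
      rw [Prod.dist_eq, Prod.dist_eq]
      simp [dist_eq_norm, sub_sub, add_comm]
    rw [h4]
    linarith
  refine ⟨key h, fun q hq hn => ?_⟩
  obtain ⟨p, hp, hd⟩ := key (near_symm h) q hq hn
  exact ⟨p, hp, by rwa [dist_comm]⟩

instance : ContinuousConstVAdd (E d) (LabeledDelone d X) where
  continuous_const_vadd v := by
    apply UniformContinuous.continuous
    refine (hasBasis_uniformity.uniformContinuous_iff hasBasis_uniformity).2 fun ε hε => ?_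
    obtain ⟨δ, hδ, h1, h2⟩ := exists_near_scale hε (norm_nonneg v)
    exact ⟨δ, hδ, fun S T h => near_vadd (by linarith) (by linarith) h⟩

instance : MeasurableSpace (LabeledDelone d X) := borel _

instance : BorelSpace (LabeledDelone d X) := ⟨rfl⟩

/-- The hull of a labelled Delone set: the closure of its orbit under translation. -/
def hull (T : LabeledDelone d X) : Set (LabeledDelone d X) :=
  closure (AddAction.orbit (E d) T)

theorem vadd_mem_hull {T S : LabeledDelone d X} (v : E d) (h : S ∈ hull T) :
    v +ᵥ S ∈ hull T := by
  refine map_mem_closure (continuous_const_vadd v) h ?_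
  rintro _ ⟨w, rfl⟩
  exact ⟨v + w, add_vadd _ _ _⟩

end LabeledDelone

open LabeledDelone

/-- A (minimal, aperiodic) tiling space of dimension `d`: the hull of a labelled Delone set with
labels in some compact metric space, such that every orbit is dense and no element has a nonzero
period. No finite local complexity is assumed. -/
structure TilingSpace (d : ℕ) : Type (u + 1) where
  Label : Type u
  [metricLabel : MetricSpace Label]
  [compactLabel : CompactSpace Label]
  carrier : Set (LabeledDelone d Label)
  exists_hull : ∃ T, carrier = hull T
  minimal : ∀ T ∈ carrier, hull T = carrier
  aperiodic : ∀ T ∈ carrier, ∀ x : E d, x +ᵥ T = T → x = 0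

attribute [instance] TilingSpace.metricLabel TilingSpace.compactLabel

namespace TilingSpace

variable {d : ℕ}

instance : CoeSort (TilingSpace.{u} d) (Type u) := ⟨fun Ω => Ω.carrier⟩

/-- The translation action of `ℝᵈ` on a tiling space. -/
instance (Ω : TilingSpace.{u} d) : AddAction (E d) Ω where
  vadd x T := ⟨x +ᵥ T.1, by
    obtain ⟨S, hS⟩ := Ω.exists_hull
    exact hS.ge (vadd_mem_hull x (hS.le T.2))⟩
  zero_vadd T := Subtype.ext (zero_vadd (E d) T.1)
  add_vadd x y T := Subtype.ext (add_vadd x y T.1)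

/-- There is exactly one translation-invariant Borel probability measure. -/
def UniquelyErgodic (Ω : TilingSpace.{u} d) : Prop :=
  ∃! μ : Measure Ω, IsProbabilityMeasure μ ∧ VAddInvariantMeasure (E d) Ω μ

/-- `Ω` and `Ω'` are orbit equivalent: some homeomorphism sends orbits onto orbits. -/
def OrbitEquivalent (Ω Ω' : TilingSpace.{u} d) : Prop :=
  ∃ h : Ω ≃ₜ Ω', ∀ T : Ω, h '' AddAction.orbit (E d) T = AddAction.orbit (E d) (h T)

/-- `Ω` and `Ω'` are topologically conjugate: some homeomorphism commutes with translations. -/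
def Conjugate (Ω Ω' : TilingSpace.{u} d) : Prop :=
  ∃ h : Ω ≃ₜ Ω', ∀ (T : Ω) (x : E d), h (x +ᵥ T) = x +ᵥ h T

/-- A continuous (weak) dynamical `1`-cocycle on `Ω` with values in `ℝᵈ`:
`α (T, x) + α (T - x, y) = α (T, x + y)`. -/
structure IsCocycle (Ω : TilingSpace.{u} d) (α : Ω → E d → E d) : Prop where
  continuous : Continuous fun p : Ω × E d => α p.1 p.2
  add : ∀ (T : Ω) (x y : E d), α T x + α ((-x) +ᵥ T) y = α T (x + y)

/-- The homeomorphism `h : Ω → Ω'` is the continuous shape change induced by the cocycle `α`.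
Every `T` is deformed by the homeomorphism `φ = α (T, ·)` of `ℝᵈ`: the points of `h T` are exactly
the points `φ x`, where `x` is a point of `T`, and `h (T - x) = h T - φ x` for all `x ∈ ℝᵈ`.
The combinatorics is kept: the label of `φ x` in `h T` may be finer than the label of `x` in `T`,
but it determines the latter (through the map `ρ`). -/
structure IsShapeChange (Ω Ω' : TilingSpace.{u} d) (h : Ω ≃ₜ Ω') (α : Ω → E d → E d) : Prop where
  cocycle : IsCocycle Ω α
  isHomeomorph : ∀ T : Ω, IsHomeomorph (α T)
  map_sub : ∀ (T : Ω) (x : E d), h ((-x) +ᵥ T) = (-(α T x)) +ᵥ h T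
  points_eq : ∀ T : Ω, (h T).1.points = α T '' T.1.points
  label : ∃ ρ : Ω'.Label → Ω.Label, ∀ (T : Ω) (x : E d) (l : Ω.Label) (l' : Ω'.Label),
    (x, l) ∈ T.1.graph → (α T x, l') ∈ (h T).1.graph → ρ l' = l

/-- `Ω'` is obtained from `Ω` by a continuous shape change. -/
def ShapeChange (Ω Ω' : TilingSpace.{u} d) : Prop :=
  ∃ (h : Ω ≃ₜ Ω') (α : Ω → E d → E d), IsShapeChange Ω Ω' h α

end TilingSpace

/-- Uniquely ergodic tiling spaces of dimension `d`, with or without finite local complexity. -/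
abbrev UETilingSpace (d : ℕ) : Type (u + 1) :=
  {Ω : TilingSpace.{u} d // Ω.UniquelyErgodic}

end TilingShape

/-!
An orbit equivalence `h : Ω → Ω'` satisfies `h (T - x) = h T - α (T, x)` for a unique function `α`,
because the action on `Ω'` is free. Near `h T` one can select a point `P S ∈ S` continuously. Along
a short path `x` from `0`, the element `h (T - x) - P (h (T - x))` stays among the countably many
translates of `h T` by one of its points, so it is constant; that is,
`α (T, x) = P (h T) - P (h (T - x))`, which is continuous. The cocycle identity spreads this over
all `x`, so that `α` is a continuous cocycle, with inverse coming from `h⁻¹`.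

Now move each point `x` of `T` to `α (T, x)` and label it by the whole of `T - x`. The label records
everything about `T`, so the deformed sets form a tiling space `Ω''`; it is a shape change of `Ω` by
construction, and it is conjugate to `Ω'` because both are obtained from `Ω` with the cocycle `α`.
-/

namespace TilingShape

section Intertwines

variable {V W M N : Type*} [AddGroup V] [AddGroup W] [AddAction V M] [AddAction W N]
  {f : M → N} {g : N → M} {α : M → V → W} {β : N → W → V}

/-- `f` sends translation orbits into translation orbits, at the rate prescribed by `α`:
`f (T - x) = f T - α (T, x)`. -/
def Intertwines (f : M → N) (α : M → V → W) : Prop :=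
  ∀ (T : M) (x : V), f (-x +ᵥ T) = -(α T x) +ᵥ f T

theorem exists_intertwines
    (hf : ∀ T, f '' AddAction.orbit V T ⊆ AddAction.orbit W (f T)) :
    ∃ α : M → V → W, Intertwines f α := by
  have hex : ∀ (T : M) (x : V), ∃ y : W, f (-x +ᵥ T) = -y +ᵥ f T := fun T x => by
    obtain ⟨y, hy⟩ := hf T (mem_image_of_mem f ⟨-x, rfl⟩)
    exact ⟨-y, by rw [neg_neg]; exact hy.symm⟩
  choose α hα using hex
  exact ⟨α, hα⟩

namespace Intertwines

theorem image_orbit (hf : Intertwines f α) {T : M} (hα : Function.Surjective (α T)) :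
    f '' AddAction.orbit V T = AddAction.orbit W (f T) := by
  refine Subset.antisymm ?_ ?_
  · rintro _ ⟨_, ⟨x, rfl⟩, rfl⟩
    exact ⟨-(α T (-x)), by simpa using (hf T (-x)).symm⟩
  · rintro _ ⟨y, rfl⟩
    obtain ⟨x, hx⟩ := hα (-y)
    exact ⟨-x +ᵥ T, ⟨-x, rfl⟩, by rw [hf, hx, neg_neg]⟩

theorem cocycle_eq [IsCancelVAdd W N] (hf : Intertwines f α) {T : M} {x : V} {y : W}
    (hy : f (-x +ᵥ T) = -y +ᵥ f T) : α T x = y :=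
  neg_injective (IsCancelVAdd.right_cancel _ _ _ ((hf T x).symm.trans hy))

theorem cocycle_zero [IsCancelVAdd W N] (hf : Intertwines f α) (T : M) : α T 0 = 0 :=
  hf.cocycle_eq (by simp)

theorem cocycle_add [IsCancelVAdd W N] (hf : Intertwines f α) (T : M) (x y : V) :
    α T x + α (-x +ᵥ T) y = α T (x + y) := by
  refine (hf.cocycle_eq ?_).symm
  rw [neg_add_rev, add_vadd, hf, hf, vadd_vadd, neg_add_rev]

theorem cocycle_leftInverse [IsCancelVAdd V M] (hf : Intertwines f α) (hg : Intertwines g β)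
    (hgf : Function.LeftInverse g f) (T : M) : Function.LeftInverse (β (f T)) (α T) :=
  fun x => hg.cocycle_eq (by rw [← hf, hgf, hgf])

theorem cocycle_rightInverse [IsCancelVAdd W N] (hf : Intertwines f α) (hg : Intertwines g β)
    (hgf : Function.LeftInverse g f) (hfg : Function.RightInverse g f) (T : M) :
    Function.RightInverse (β (f T)) (α T) := fun y => by
  simpa only [hgf T] using hg.cocycle_leftInverse hf hfg (f T) y

end Intertwines

end Intertwines

section LowerLimit

variable {ι Y : Type*} [PseudoMetricSpace Y] {G : ι → Set Y} {K : Set Y} {ε : ℝ}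

/-- The Kuratowski lower limit of the sets `G i` along the filter `F`: the points that are
approximated by points of `G i`, for `F`-almost all `i`. -/
def lowerLimit (F : Filter ι) (G : ι → Set Y) : Set Y :=
  {p | ∀ ε : ℝ, 0 < ε → ∀ᶠ i in F, ∃ q ∈ G i, dist p q < ε}

theorem lowerLimit_inter_nonempty {F : Ultrafilter ι} (hK : IsCompact K)
    (hF : ∀ᶠ i in F, (G i ∩ K).Nonempty) : (lowerLimit F G ∩ K).Nonempty := by
  have : Nonempty Y := hF.exists.elim fun _ h => ⟨h.some⟩
  choose! f hf using fun i (h : (G i ∩ K).Nonempty) => h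
  have hfK : ↑(F.map f) ≤ 𝓟 K := le_principal_iff.2 (hF.mono fun i hi => (hf i hi).2)
  obtain ⟨p, hpK, hp⟩ := hK.ultrafilter_le_nhds (F.map f) hfK
  refine ⟨p, fun ε hε => ?_, hpK⟩
  have hfp : ∀ᶠ i in F, f i ∈ Metric.ball p ε := hp (Metric.ball_mem_nhds p hε)
  filter_upwards [hfp, hF] with i hip hi
  exact ⟨f i, (hf i hi).1, Metric.mem_ball'.1 hip⟩

theorem eventually_exists_dist_lt_of_mem_lowerLimit {F : Filter ι} (hK : TotallyBounded K)
    (hε : 0 < ε) : ∀ᶠ i in F, ∀ p ∈ lowerLimit F G ∩ K, ∃ q ∈ G i, dist p q < ε := by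
  obtain ⟨t, htG, htf, ht⟩ := Metric.finite_approx_of_totallyBounded
    (hK.subset (inter_subset_right (s := lowerLimit F G))) (ε / 2) (half_pos hε)
  filter_upwards [(eventually_all_finite htf).2 fun c hc => (htG hc).1 (ε / 2) (half_pos hε)]
    with i hi p hp
  obtain ⟨c, hc, hpc⟩ := mem_iUnion₂.1 (ht hp)
  obtain ⟨q, hq, hcq⟩ := hi c hc
  exact ⟨q, hq, by linarith [dist_triangle p c q, Metric.mem_ball.1 hpc]⟩

theorem eventually_exists_mem_lowerLimit_dist_lt {F : Ultrafilter ι} (hK : IsCompact K)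
    (hε : 0 < ε) : ∀ᶠ i in F, ∀ q ∈ G i ∩ K, ∃ p ∈ lowerLimit F G, dist q p < ε := by
  -- Otherwise some points of `G i` far from the lower limit would accumulate in the lower limit.
  by_contra hF
  have hfar : ∀ᶠ i in F, (G i ∩ (K \ Metric.thickening ε (lowerLimit F G))).Nonempty := by
    filter_upwards [Ultrafilter.eventually_not.2 hF] with i hi
    push Not at hi
    obtain ⟨q, ⟨hqG, hqK⟩, hq⟩ := hi
    refine ⟨q, hqG, hqK, fun hq' => ?_⟩
    obtain ⟨p, hp, hqp⟩ := Metric.mem_thickening_iff.1 hq'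
    exact (hq p hp).not_gt hqp
  obtain ⟨p, hp, -, hp'⟩ := lowerLimit_inter_nonempty (hK.diff Metric.isOpen_thickening) hfar
  exact hp' (Metric.self_subset_thickening hε _ hp)

end LowerLimit

section IsDeloneGraph

variable {d : ℕ} {X : Type u} {r R : ℝ} {G : Set (E d × X)}

/-- The first components of `G` form a Delone set with separation `r` and covering radius `R`, and
the points of `G` are determined by their first components. -/
structure IsDeloneGraph (r R : ℝ) (G : Set (E d × X)) : Prop where
  eq_of_dist_lt : ∀ p ∈ G, ∀ q ∈ G, dist p.1 q.1 < r → p = q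
  exists_dist_le : ∀ x : E d, ∃ p ∈ G, dist x p.1 ≤ R

namespace IsDeloneGraph

theorem exists_deloneSet (hr : 0 < r) (hG : IsDeloneGraph r R G) :
    ∃ D : Delone.DeloneSet (E d), D.carrier = Prod.fst '' G := by
  refine ⟨⟨Prod.fst '' G, (r / 2).toNNReal, by simpa using hr, ?_, (max R 1).toNNReal,
    by simp, ?_⟩, rfl⟩
  · rintro _ ⟨p, hp, rfl⟩ _ ⟨q, hq, rfl⟩ hne
    have h : r ≤ dist p.1 q.1 :=
      not_lt.1 fun hlt => hne (congrArg Prod.fst (hG.eq_of_dist_lt p hp q hq hlt))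
    change ENNReal.ofReal (r / 2) < edist p.1 q.1
    rw [edist_dist, ENNReal.ofReal_lt_ofReal_iff (by linarith)]
    linarith
  · intro x _
    obtain ⟨p, hp, hxp⟩ := hG.exists_dist_le x
    refine ⟨p.1, mem_image_of_mem _ hp, ?_⟩
    change edist x p.1 ≤ ENNReal.ofReal (max R 1)
    rw [edist_dist]
    exact ENNReal.ofReal_le_ofReal (hxp.trans (le_max_left _ _))

theorem vadd {T : LabeledDelone d X} (hT : IsDeloneGraph r R T.graph) (v : E d) :
    IsDeloneGraph r R (v +ᵥ T).graph where
  eq_of_dist_lt p hp q hq hpq := by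
    have h := hT.eq_of_dist_lt _ (LabeledDelone.mem_vadd.1 hp) _ (LabeledDelone.mem_vadd.1 hq)
      (by simpa using hpq)
    simpa [Prod.ext_iff] using h
  exists_dist_le x := by
    obtain ⟨p, hp, hxp⟩ := hT.exists_dist_le (x - v)
    refine ⟨(p.1 + v, p.2), LabeledDelone.mem_vadd.2 (by simpa using hp), ?_⟩
    rwa [dist_eq_norm, add_comm, ← sub_sub, ← dist_eq_norm]

variable [MetricSpace X]

theorem isClosed (hr : 0 < r) (hG : IsDeloneGraph r R G) : IsClosed G :=
  Metric.isClosed_of_pairwise_le_dist hr fun p hp q hq hne =>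
    (not_lt.1 fun hlt => hne (hG.eq_of_dist_lt p hp q hq hlt)).trans (le_max_left _ _)

theorem lowerLimit [CompactSpace X] {ι : Type*} {F : Ultrafilter ι} {G : ι → Set (E d × X)}
    (hG : ∀ᶠ i in F, IsDeloneGraph r R (G i)) :
    IsDeloneGraph r R (lowerLimit F G) where
  eq_of_dist_lt p hp q hq hpq := by
    refine eq_of_forall_dist_le fun ε hε => ?_
    obtain ⟨η, hη, hηε, hηr⟩ : ∃ η > 0, η ≤ ε / 2 ∧ η ≤ (r - dist p.1 q.1) / 2 :=
      ⟨min (ε / 2) ((r - dist p.1 q.1) / 2), lt_min (half_pos hε) (half_pos (sub_pos.2 hpq)),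
        min_le_left _ _, min_le_right _ _⟩
    obtain ⟨i, ⟨⟨p', hp', hpp'⟩, q', hq', hqq'⟩, hi⟩ :=
      (((hp η hη).and (hq η hη)).and hG).exists
    have hp1 : dist p'.1 p.1 ≤ dist p p' := dist_comm p p' ▸ le_max_left _ _
    have hq1 : dist q.1 q'.1 ≤ dist q q' := le_max_left _ _
    have hpq' : p' = q' := hi.eq_of_dist_lt p' hp' q' hq' (by
      linarith [dist_triangle4 p'.1 p.1 q.1 q'.1])
    subst hpq'
    linarith [dist_triangle_right p q p']
  exists_dist_le x := by
    have hF : ∀ᶠ i in F, (G i ∩ Metric.closedBall x R ×ˢ univ).Nonempty :=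
      hG.mono fun i hi => by
        obtain ⟨p, hp, hxp⟩ := hi.exists_dist_le x
        exact ⟨p, hp, Metric.mem_closedBall'.2 hxp, mem_univ _⟩
    obtain ⟨p, hp, hpx, -⟩ :=
      lowerLimit_inter_nonempty ((isCompact_closedBall x R).prod isCompact_univ) hF
    exact ⟨p, hp, Metric.mem_closedBall'.1 hpx⟩

end IsDeloneGraph

end IsDeloneGraph

namespace LabeledDelone

variable {d : ℕ} {X : Type u} {r R : ℝ}

theorem exists_isDeloneGraph (T : LabeledDelone d X) :
    ∃ r R : ℝ, 0 < r ∧ IsDeloneGraph r R T.graph := by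
  obtain ⟨D, hD⟩ := T.isDelone
  have hmem : ∀ x, x ∈ D ↔ x ∈ Prod.fst '' T.graph := fun x => hD ▸ Iff.rfl
  refine ⟨D.packingRadius, D.coveringRadius, D.packingRadius_pos, fun p hp q hq hpq => ?_,
    fun x => ?_⟩
  · have hfst : p.1 = q.1 := by
      by_contra hne
      exact (D.packingRadius_lt_dist_of_mem_ne ((hmem _).2 (mem_image_of_mem _ hp))
        ((hmem _).2 (mem_image_of_mem _ hq)) hne).not_gt hpq
    exact Prod.ext hfst (T.functional p hp q hq hfst)
  · obtain ⟨y, hy, hxy⟩ := D.exists_dist_le_coveringRadius x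
    obtain ⟨p, hp, rfl⟩ := (hmem y).1 hy
    exact ⟨p, hp, hxy⟩

theorem eq_of_mem_points_of_dist_lt {T : LabeledDelone d X} (hT : IsDeloneGraph r R T.graph)
    {x y : E d} (hx : x ∈ T.points) (hy : y ∈ T.points) (hxy : dist x y < r) : x = y := by
  obtain ⟨p, hp, rfl⟩ := hx
  obtain ⟨q, hq, rfl⟩ := hy
  exact congrArg Prod.fst (hT.eq_of_dist_lt p hp q hq hxy)

theorem points_nonempty (T : LabeledDelone d X) : T.points.Nonempty := by
  obtain ⟨r, R, -, hT⟩ := T.exists_isDeloneGraph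
  obtain ⟨p, hp, -⟩ := hT.exists_dist_le 0
  exact ⟨p.1, mem_image_of_mem _ hp⟩

theorem countable_points (T : LabeledDelone d X) : T.points.Countable := by
  obtain ⟨r, R, hr, hT⟩ := T.exists_isDeloneGraph
  have : DiscreteTopology T.points := DiscreteTopology.of_forall_le_dist hr fun x y hne =>
    not_lt.1 fun hlt => hne (Subtype.ext (eq_of_mem_points_of_dist_lt hT x.2 y.2 hlt))
  exact countable_coe_iff.1 (TopologicalSpace.separableSpace_iff_countable.1 inferInstance)

theorem points_vadd (v : E d) (T : LabeledDelone d X) :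
    (v +ᵥ T).points = (fun x => v + x) '' T.points := by
  change Prod.fst '' ((fun p : E d × X => (v + p.1, p.2)) '' T.graph) = _ '' (Prod.fst '' T.graph)
  rw [image_image, image_image]

variable [MetricSpace X]

instance : T0Space (LabeledDelone d X) := by
  refine t0Space_iff_uniformity.2 fun S T h => ?_
  have hnear : ∀ ε : ℝ, 0 < ε → (S, T) ∈ near d X ε :=
    fun ε hε => h _ (hasBasis_uniformity.mem_of_mem hε)
  have hsub : ∀ {S T : LabeledDelone d X}, (∀ ε : ℝ, 0 < ε → (S, T) ∈ near d X ε) →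
      S.graph ⊆ T.graph := by
    intro S T h p hp
    obtain ⟨r, R, hr, hT⟩ := T.exists_isDeloneGraph
    refine (hT.isClosed hr).closure_subset (Metric.mem_closure_iff.2 fun ε hε => ?_)
    obtain ⟨δ, hδ, hδε, hδp⟩ := exists_near_scale hε (norm_nonneg p.1)
    obtain ⟨q, hq, hpq⟩ := (h δ hδ).1 p hp (by linarith [inv_pos.2 hε])
    exact ⟨q, hq, by linarith⟩
  exact LabeledDelone.ext ((hsub hnear).antisymm (hsub fun ε hε => near_symm (hnear ε hε)))

instance : IsCountablyGenerated (𝓤 (LabeledDelone d X)) := by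
  refine HasBasis.isCountablyGenerated (ι := ℕ) (p := fun _ => True)
    (s := fun n => near d X (1 / ((n : ℝ) + 1))) ?_
  refine hasBasis_uniformity.to_hasBasis (fun ε hε => ?_) fun n _ =>
    ⟨_, by positivity, Subset.rfl⟩
  obtain ⟨n, hn⟩ := exists_nat_one_div_lt hε
  exact ⟨n, trivial, near_mono (by positivity) hn.le⟩

theorem vadd_mem_near_self {δ : ℝ} {v : E d} (hv : ‖v‖ < δ) (T : LabeledDelone d X) :
    (v +ᵥ T, T) ∈ near d X δ := by
  have hδ : 0 < δ := (norm_nonneg v).trans_lt hv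
  refine ⟨fun p hp _ => ⟨_, mem_vadd.1 hp, ?_⟩, fun p hp _ =>
    ⟨(p.1 + v, p.2), mem_vadd.2 (by simpa using hp), ?_⟩⟩ <;>
  simpa [Prod.dist_eq, hδ] using hv

theorem continuousAt_vadd_zero (T : LabeledDelone d X) :
    ContinuousAt (fun q : E d × LabeledDelone d X => q.1 +ᵥ q.2) (0, T) := by
  refine (nhds_basis_uniformity hasBasis_uniformity).tendsto_right_iff.2 fun ε hε => ?_
  obtain ⟨δ, hδ, hδε, hδ'⟩ := exists_near_scale hε le_rfl
  filter_upwards [prod_mem_nhds (Metric.ball_mem_nhds (0 : E d) hδ)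
    ((nhds_basis_uniformity hasBasis_uniformity).mem_of_mem hδ)] with q ⟨hv, hS⟩
  simpa using near_comp hδε (by linarith) hδ
    (vadd_mem_near_self (mem_ball_zero_iff.1 hv) q.2) hS

instance : ContinuousVAdd (E d) (LabeledDelone d X) where
  continuous_vadd := by
    rw [continuous_iff_continuousAt]
    rintro ⟨v, T⟩
    have hshift : ContinuousAt
        (fun q : E d × LabeledDelone d X => (q.1 - v, v +ᵥ q.2)) (v, T) := by fun_prop
    refine (ContinuousAt.comp_of_eq (continuousAt_vadd_zero (v +ᵥ T)) hshift (by simp)).congr ?_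
    exact Eventually.of_forall fun q => by simp [vadd_vadd]

theorem isCompact_setOf_isDeloneGraph [CompactSpace X] (hr : 0 < r) :
    IsCompact {T : LabeledDelone d X | IsDeloneGraph r R T.graph} := by
  rw [isCompact_iff_ultrafilter_le_nhds']
  intro F hF
  have hL : IsDeloneGraph r R (lowerLimit F (graph (d := d) (X := X))) := .lowerLimit hF
  refine ⟨⟨_, fun p hp q hq h => congrArg Prod.snd (hL.eq_of_dist_lt p hp q hq (by simpa [h])),
    hL.exists_deloneSet hr⟩, hL, ?_⟩
  refine (nhds_basis_uniformity hasBasis_uniformity).ge_iff.2 fun ε hε => ?_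
  have hK : IsCompact (Metric.closedBall (0 : E d) ε⁻¹ ×ˢ (univ : Set X)) :=
    (isCompact_closedBall _ _).prod isCompact_univ
  have hmemK : ∀ p : E d × X, ‖p.1‖ < ε⁻¹ →
      p ∈ Metric.closedBall (0 : E d) ε⁻¹ ×ˢ (univ : Set X) :=
    fun p hp => ⟨mem_closedBall_zero_iff.2 hp.le, mem_univ _⟩
  filter_upwards [eventually_exists_mem_lowerLimit_dist_lt hK hε,
    eventually_exists_dist_lt_of_mem_lowerLimit hK.totallyBounded hε] with S hSL hLS
  refine ⟨fun p hp hpn => hSL p ⟨hp, hmemK p hpn⟩, fun q hq hqn => ?_⟩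
  simpa only [dist_comm] using hLS q ⟨hq, hmemK q hqn⟩

theorem exists_hull_subset [CompactSpace X] (T : LabeledDelone d X) :
    ∃ r R : ℝ, 0 < r ∧ hull T ⊆ {S | IsDeloneGraph r R S.graph} := by
  obtain ⟨r, R, hr, hT⟩ := T.exists_isDeloneGraph
  refine ⟨r, R, hr, closure_minimal ?_ (isCompact_setOf_isDeloneGraph hr).isClosed⟩
  rintro _ ⟨v, rfl⟩
  exact hT.vadd v

theorem isCompact_hull [CompactSpace X] (T : LabeledDelone d X) : IsCompact (hull T) := by
  obtain ⟨r, R, hr, hT⟩ := T.exists_hull_subset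
  exact (isCompact_setOf_isDeloneGraph hr).of_isClosed_subset isClosed_closure hT

theorem isOpen_setOf_points_inter_nonempty {V : Set (E d)} (hV : IsOpen V) :
    IsOpen {S : LabeledDelone d X | (S.points ∩ V).Nonempty} := by
  rw [isOpen_iff_mem_nhds]
  rintro S ⟨_, ⟨p, hp, rfl⟩, hpV⟩
  obtain ⟨ε, hε, hεV⟩ := Metric.isOpen_iff.1 hV _ hpV
  obtain ⟨δ, hδ, hδε, hδp⟩ := exists_near_scale hε (norm_nonneg p.1)
  filter_upwards [(nhds_basis_uniformity' hasBasis_uniformity).mem_of_mem hδ] with S' hS'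
  obtain ⟨q, hq, hpq⟩ := hS'.1 p hp (by linarith [inv_pos.2 hε])
  refine ⟨q.1, mem_image_of_mem _ hq, hεV (Metric.mem_ball'.2 ?_)⟩
  exact (le_max_left _ _).trans_lt (hpq.trans_le (by linarith))

end LabeledDelone

open LabeledDelone

namespace TilingSpace

variable {d : ℕ}

section Topology

variable (Ω : TilingSpace.{u} d)

instance : Nonempty Ω := by
  obtain ⟨T, hT⟩ := Ω.exists_hull
  exact ⟨⟨T, hT.ge (subset_closure (AddAction.mem_orbit_self T))⟩⟩

instance : CompactSpace Ω := by
  obtain ⟨T, hT⟩ := Ω.exists_hull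
  exact isCompact_iff_compactSpace.1 (hT ▸ isCompact_hull T)

instance : ContinuousVAdd (E d) Ω where
  continuous_vadd := Continuous.subtype_mk
    (continuous_fst.vadd (continuous_subtype_val.comp continuous_snd)) _

instance : IsCancelVAdd (E d) Ω :=
  isCancelVAdd_iff_eq_zero_of_vadd_eq.2 fun x T h =>
    Ω.aperiodic T.1 T.2 x (congrArg Subtype.val h)

instance : AddAction.IsMinimal (E d) Ω where
  dense_orbit T S := by
    have horbit : AddAction.orbit (E d) T.1 = Subtype.val '' AddAction.orbit (E d) T :=
      range_comp Subtype.val fun x : E d => x +ᵥ T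
    rw [closure_subtype, ← horbit]
    exact (Ω.minimal T.1 T.2).ge S.2

/-- A metric inducing the uniform structure of `Ω`. It has no further meaning, and serves to use the
elements of `Ω` as labels. -/
noncomputable instance : MetricSpace Ω :=
  UniformSpace.metricSpace Ω

theorem exists_isDeloneGraph :
    ∃ r R : ℝ, 0 < r ∧ ∀ T : Ω, IsDeloneGraph r R T.1.graph := by
  obtain ⟨T, hT⟩ := Ω.exists_hull
  obtain ⟨r, R, hr, h⟩ := T.exists_hull_subset
  exact ⟨r, R, hr, fun S => h (hT.le S.2)⟩

variable {Ω}

theorem exists_continuousOn_mem_points (T : Ω) :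
    ∃ (U : Set Ω) (P : Ω → E d), IsOpen U ∧ T ∈ U ∧ ContinuousOn P U ∧
      ∀ S ∈ U, P S ∈ S.1.points := by
  obtain ⟨r, R, hr, hΩ⟩ := Ω.exists_isDeloneGraph
  obtain ⟨p, hp⟩ := T.1.points_nonempty
  have hopen : ∀ V : Set (E d), IsOpen V → IsOpen {S : Ω | (S.1.points ∩ V).Nonempty} :=
    fun V hV => (isOpen_setOf_points_inter_nonempty hV).preimage continuous_subtype_val
  choose! P hP using fun (S : Ω) (h : (S.1.points ∩ Metric.ball p (r / 2)).Nonempty) => h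
  have hP_unique : ∀ S : Ω, ∀ q ∈ S.1.points ∩ Metric.ball p (r / 2), P S = q := by
    rintro S q ⟨hq, hqp⟩
    obtain ⟨hPS, hPp⟩ := hP S ⟨q, hq, hqp⟩
    refine eq_of_mem_points_of_dist_lt (hΩ S) hPS hq ?_
    linarith [dist_triangle_right (P S) q p, Metric.mem_ball.1 hPp, Metric.mem_ball.1 hqp]
  refine ⟨{S | (S.1.points ∩ Metric.ball p (r / 2)).Nonempty}, P, hopen _ Metric.isOpen_ball,
    ⟨p, hp, Metric.mem_ball_self (half_pos hr)⟩, fun S hS => ?_, fun S hS => (hP S hS).1⟩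
  refine ContinuousAt.continuousWithinAt (Metric.tendsto_nhds.2 fun ε hε => ?_)
  filter_upwards [(hopen _ (Metric.isOpen_ball.inter Metric.isOpen_ball)).mem_nhds
    ⟨P S, (hP S hS).1, (hP S hS).2, Metric.mem_ball_self hε⟩] with S' ⟨q, hq, hqp, hqε⟩
  rwa [hP_unique S' q ⟨hq, hqp⟩]

end Topology

end TilingSpace

namespace Intertwines

open TilingSpace

variable {d : ℕ} {Ω : TilingSpace.{u} d} {V M : Type*} [AddGroup V] [TopologicalSpace V]
  [TopologicalSpace M] [AddAction V M] {f : M → Ω} {α : M → V → E d}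

theorem eq_sub_of_isPreconnected [ContinuousNeg V] [ContinuousVAdd V M]
    (hf : Intertwines f α) (hfc : Continuous f) {U : Set Ω} {P : Ω → E d}
    (hPc : ContinuousOn P U) (hP : ∀ S ∈ U, P S ∈ S.1.points) {T : M} {A : Set V}
    (hA : IsPreconnected A) (h0 : 0 ∈ A) (hAU : ∀ x ∈ A, f (-x +ᵥ T) ∈ U) {x : V} (hx : x ∈ A) :
    α T x = P (f T) - P (f (-x +ᵥ T)) := by
  let π : V → Ω := fun x => -P (f (-x +ᵥ T)) +ᵥ f (-x +ᵥ T)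
  have hγ : Continuous fun x : V => f (-x +ᵥ T) := by fun_prop
  have hπ : ContinuousOn π A := (hPc.comp hγ.continuousOn hAU).neg.vadd hγ.continuousOn
  have hπ_eq : ∀ x, π x = -(α T x + P (f (-x +ᵥ T))) +ᵥ f T := fun x => by
    simp only [π, neg_add_rev, add_vadd, ← hf T x]
  -- Countability needs no continuity of `α`: the values of `π` move a point of `f T` to `0`.
  have hcount : (π '' A).Countable := by
    refine ((f T).1.countable_points.image fun c => -c +ᵥ f T).mono ?_
    rintro _ ⟨x, hx, rfl⟩
    refine ⟨_, ?_, (hπ_eq x).symm⟩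
    obtain ⟨c, hc, hcx⟩ := (points_vadd _ _).le (hf T x ▸ hP _ (hAU x hx))
    simpa [hf T x, ← hcx] using hc
  have hπ0 : π x = π 0 := hcount.isTotallyDisconnected _ Subset.rfl (hA.image _ hπ)
    (mem_image_of_mem _ hx) (mem_image_of_mem _ h0)
  rw [hπ_eq, hπ_eq] at hπ0
  have hsum := neg_injective (IsCancelVAdd.right_cancel _ _ _ hπ0)
  rw [hf.cocycle_zero, neg_zero, zero_vadd, zero_add] at hsum
  exact eq_sub_of_add_eq hsum

theorem eventually_continuousAt [ContinuousNeg V] [ContinuousVAdd V M] [LocallyConnectedSpace V]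
    (hf : Intertwines f α) (hfc : Continuous f) (T : M) :
    ∀ᶠ p in 𝓝 (T, (0 : V)), ContinuousAt (fun p : M × V => α p.1 p.2) p := by
  obtain ⟨U, P, hU, hTU, hPc, hP⟩ := exists_continuousOn_mem_points (f T)
  have hγ : Continuous fun p : M × V => f (-p.2 +ᵥ p.1) := by fun_prop
  obtain ⟨O, W, hO, hTO, hW, h0W, hOW⟩ := mem_nhds_prod_iff'.1
    ((hU.preimage hγ).mem_nhds (show (T, (0 : V)) ∈ _ by simpa using hTU))
  obtain ⟨A, hAW, hA, h0A, hAc⟩ :=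
    locallyConnectedSpace_iff_subsets_isOpen_isConnected.1 ‹_› 0 W (hW.mem_nhds h0W)
  have hOA : ∀ S ∈ O, ∀ x ∈ A, f (-x +ᵥ S) ∈ U := fun S hS x hx =>
    hOW (mk_mem_prod hS (hAW hx))
  have hα : ContinuousOn (fun p : M × V => α p.1 p.2) (O ×ˢ A) := by
    refine ContinuousOn.congr (f := fun p : M × V => P (f p.1) - P (f (-p.2 +ᵥ p.1)))
      (.sub (hPc.comp (by fun_prop) fun p hp => ?_)
        (hPc.comp hγ.continuousOn fun p hp => hOA p.1 hp.1 p.2 hp.2))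
      fun p hp => hf.eq_sub_of_isPreconnected hfc hPc hP hAc.isPreconnected h0A (hOA p.1 hp.1) hp.2
    simpa using hOA p.1 hp.1 0 h0A
  filter_upwards [(hO.prod hA).mem_nhds ⟨hTO, h0A⟩] with p hp
  exact hα.continuousAt ((hO.prod hA).mem_nhds hp)

theorem continuousAt_of_continuousAt [IsTopologicalAddGroup V] [ContinuousConstVAdd V M]
    (hf : Intertwines f α) {T : M} {x y : V}
    (hx : ContinuousAt (fun p : M × V => α p.1 p.2) (T, x))
    (hy : ContinuousAt (fun p : M × V => α p.1 p.2) (-x +ᵥ T, -x + y)) :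
    ContinuousAt (fun p : M × V => α p.1 p.2) (T, y) := by
  have hsplit : (fun p : M × V => α p.1 p.2) =
      fun p => α p.1 x + α (-x +ᵥ p.1) (-x + p.2) := funext fun p => by
    rw [hf.cocycle_add, add_neg_cancel_left]
  rw [hsplit]
  exact .add
    (hx.comp_of_eq (g := fun p : M × V => α p.1 p.2) (f := fun p : M × V => (p.1, x))
      (by fun_prop) rfl)
    (hy.comp_of_eq (g := fun p : M × V => α p.1 p.2)
      (f := fun p : M × V => (-x +ᵥ p.1, -x + p.2)) (by fun_prop) rfl)

theorem continuous_cocycle [IsTopologicalAddGroup V] [ContinuousVAdd V M] [PreconnectedSpace V]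
    [LocallyConnectedSpace V] (hf : Intertwines f α) (hfc : Continuous f) :
    Continuous fun p : M × V => α p.1 p.2 := by
  rw [continuous_iff_continuousAt]
  rintro ⟨T, x⟩
  refine PreconnectedSpace.induction₂'
    (fun y z : V => ContinuousAt (fun p : M × V => α p.1 p.2) (T, y) →
      ContinuousAt (fun p : M × V => α p.1 p.2) (T, z))
    (fun y => ?_) ⟨fun _ _ _ h h' => h' ∘ h⟩ 0 x (hf.eventually_continuousAt hfc T).self_of_nhds
  have hstart : Tendsto (fun z : V => (-y +ᵥ T, -y + z)) (𝓝 y) (𝓝 (-y +ᵥ T, 0)) :=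
    Continuous.tendsto' (by fun_prop) _ _ (by simp)
  have hend : Tendsto (fun z : V => (-z +ᵥ T, -z + y)) (𝓝 y) (𝓝 (-y +ᵥ T, 0)) :=
    Continuous.tendsto' (by fun_prop) _ _ (by simp)
  filter_upwards [hstart.eventually (hf.eventually_continuousAt hfc _),
    hend.eventually (hf.eventually_continuousAt hfc _)] with z hz hy
  exact ⟨fun h => hf.continuousAt_of_continuousAt h hz,
    fun h => hf.continuousAt_of_continuousAt h hy⟩

end Intertwines

section Bounds

variable {K V F : Type*} [TopologicalSpace K] [CompactSpace K] [SeminormedAddCommGroup V]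
  [SeminormedAddCommGroup F] {α : K → V → F}

theorem exists_forall_norm_le [ProperSpace V] (hα : Continuous fun p : K × V => α p.1 p.2)
    (R : ℝ) : ∃ C : ℝ, ∀ (k : K) (x : V), ‖x‖ ≤ R → ‖α k x‖ ≤ C := by
  obtain ⟨C, hC⟩ := ((isCompact_univ (X := K)).prod
    (isCompact_closedBall (0 : V) R)).exists_bound_of_continuousOn hα.continuousOn
  exact ⟨C, fun k x hx => hC (k, x) ⟨mem_univ _, mem_closedBall_zero_iff.2 hx⟩⟩

theorem exists_forall_norm_lt (hα : Continuous fun p : K × V => α p.1 p.2)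
    (h0 : ∀ k, α k 0 = 0) {r : ℝ} (hr : 0 < r) :
    ∃ s : ℝ, 0 < s ∧ ∀ (k : K) (x : V), ‖x‖ < s → ‖α k x‖ < r := by
  have hev : ∀ᶠ x in 𝓝 (0 : V), ∀ k ∈ (univ : Set K), ‖α k x‖ < r := by
    refine isCompact_univ.eventually_forall_of_forall_eventually fun k _ => ?_
    have hcont : Continuous fun z : V × K => ‖α z.2 z.1‖ := (hα.comp continuous_swap).norm
    exact hcont.continuousAt.eventually_lt_const (by simpa [h0] using hr)
  obtain ⟨s, hs, hsr⟩ := Metric.eventually_nhds_iff.1 hev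
  exact ⟨s, hs, fun k x hx => hsr (by simpa using hx) k (mem_univ _)⟩

end Bounds

namespace TilingSpace

variable {d : ℕ} {Ω Ω' Ω'' : TilingSpace.{u} d} {α β : Ω → E d → E d}

namespace IsCocycle

theorem map_zero (hα : IsCocycle Ω α) (T : Ω) : α T 0 = 0 := by
  simpa using hα.add T 0 0

theorem map_vadd_sub (hα : IsCocycle Ω α) (T : Ω) (x y : E d) :
    α (-x +ᵥ T) (y - x) = α T y - α T x := by
  rw [eq_sub_iff_add_eq', hα.add, add_sub_cancel]

end IsCocycle

/-- `α` is a continuous cocycle such that every `α (T, ·)` is invertible, with the inverse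
`β (T, ·)` depending continuously on `T` as well. Such a cocycle is what is needed to deform all the
elements of `Ω` simultaneously. -/
structure IsInvertibleCocycle (α β : Ω → E d → E d) : Prop extends IsCocycle Ω α where
  continuous_inv : Continuous fun p : Ω × E d => β p.1 p.2
  leftInverse : ∀ T, Function.LeftInverse (β T) (α T)
  rightInverse : ∀ T, Function.RightInverse (β T) (α T)

/-- The graph of the deformation of `T` by `α`: a point `x` of `T` moves to `α (T, x)`, and its
label becomes the whole of `T - x`, so that no information on `T` is lost. -/
def deformGraph (α : Ω → E d → E d) (T : Ω) : Set (E d × Ω) :=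
  (fun x => (α T x, -x +ᵥ T)) '' T.1.points

namespace IsInvertibleCocycle

theorem inv_zero (H : IsInvertibleCocycle α β) (T : Ω) : β T 0 = 0 := by
  simpa [H.map_zero] using H.leftInverse T 0

theorem isHomeomorph (H : IsInvertibleCocycle α β) (T : Ω) : IsHomeomorph (α T) :=
  (Homeomorph.mk ⟨α T, β T, H.leftInverse T, H.rightInverse T⟩
    (H.continuous.comp (Continuous.prodMk_right T))
    (H.continuous_inv.comp (Continuous.prodMk_right T))).isHomeomorph

theorem exists_isDeloneGraph_deformGraph (H : IsInvertibleCocycle α β) :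
    ∃ r R : ℝ, 0 < r ∧ ∀ T, IsDeloneGraph r R (deformGraph α T) := by
  obtain ⟨r, R, hr, hΩ⟩ := Ω.exists_isDeloneGraph
  obtain ⟨s, hs, hsr⟩ := exists_forall_norm_lt H.continuous_inv H.inv_zero hr
  obtain ⟨C, hC⟩ := exists_forall_norm_le H.continuous R
  refine ⟨s, C, hs, fun T => ⟨?_, fun y => ?_⟩⟩
  · rintro _ ⟨x, hx, rfl⟩ _ ⟨y, hy, rfl⟩ hxy
    have hdist : dist x y < r := by
      rw [dist_eq_norm, ← H.leftInverse (-y +ᵥ T) (x - y)]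
      exact hsr _ _ (by rwa [H.map_vadd_sub, ← dist_eq_norm])
    rw [eq_of_mem_points_of_dist_lt (hΩ T) hx hy hdist]
  · obtain ⟨p, hp, hyp⟩ := (hΩ T).exists_dist_le (β T y)
    refine ⟨_, mem_image_of_mem _ (mem_image_of_mem _ hp), ?_⟩
    have hbound := hC (-β T y +ᵥ T) (p.1 - β T y) (by rwa [← dist_eq_norm, dist_comm])
    rwa [H.map_vadd_sub, H.rightInverse, ← dist_eq_norm, dist_comm] at hbound

/-- The deformation of `T` by an invertible cocycle, a Delone set labelled by elements of `Ω`. -/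
def deform (H : IsInvertibleCocycle α β) (T : Ω) : LabeledDelone d Ω where
  graph := deformGraph α T
  functional := by
    rintro _ ⟨x, -, rfl⟩ _ ⟨y, -, rfl⟩ hxy
    rw [(H.leftInverse T).injective hxy]
  isDelone := by
    obtain ⟨r, R, hr, hT⟩ := H.exists_isDeloneGraph_deformGraph
    exact (hT T).exists_deloneSet hr

theorem points_deform (H : IsInvertibleCocycle α β) (T : Ω) :
    (H.deform T).points = α T '' T.1.points :=
  image_image _ _ _

theorem intertwines_deform (H : IsInvertibleCocycle α β) : Intertwines H.deform α := by
  refine fun T x => LabeledDelone.ext ?_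
  change (fun y => (α (-x +ᵥ T) y, -y +ᵥ (-x +ᵥ T))) '' (-x +ᵥ T.1).points =
    (fun p : E d × Ω => (-α T x + p.1, p.2)) '' ((fun y => (α T y, -y +ᵥ T)) '' T.1.points)
  rw [points_vadd, image_image, image_image]
  refine image_congr fun y _ => Prod.ext ?_ ?_
  · change α (-x +ᵥ T) (-x + y) = -α T x + α T y
    rw [neg_add_eq_sub, H.map_vadd_sub, neg_add_eq_sub]
  · change -(-x + y) +ᵥ (-x +ᵥ T) = -y +ᵥ T
    rw [vadd_vadd, neg_add_rev, neg_neg, add_neg_cancel_right]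

theorem deform_injective (H : IsInvertibleCocycle α β) : Function.Injective H.deform := by
  intro S T hST
  obtain ⟨x, hx⟩ := S.1.points_nonempty
  obtain ⟨y, -, hy⟩ : (α S x, -x +ᵥ S) ∈ (H.deform T).graph := hST ▸ mem_image_of_mem _ hx
  obtain ⟨hαxy, hxy⟩ := Prod.mk.inj hy
  have hT : -(x - y) +ᵥ S = T := by
    rw [neg_sub, sub_eq_add_neg, add_vadd, ← hxy, vadd_vadd, add_neg_cancel, zero_vadd]
  have hα : α S (x - y) = α S 0 := by
    have hadd := H.add S (x - y) y
    rw [hT, hαxy, sub_add_cancel, add_eq_right] at hadd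
    rw [hadd, H.map_zero]
  rw [← hT, (H.leftInverse S).injective hα, neg_zero, zero_vadd]

theorem exists_forall_exists_mem_deformGraph_dist_lt (H : IsInvertibleCocycle α β) {ε : ℝ}
    (hε : 0 < ε) : ∃ δ : ℝ, 0 < δ ∧ ∀ S S' : Ω, dist S S' < δ → (S.1, S'.1) ∈ near d Ω.Label δ →
      ∀ p ∈ deformGraph α S, ‖p.1‖ < ε⁻¹ → ∃ q ∈ deformGraph α S', dist p q < ε := by
  obtain ⟨C, hC⟩ := exists_forall_norm_le H.continuous_inv ε⁻¹
  have hC0 : 0 ≤ C := (norm_nonneg _).trans (hC (Classical.arbitrary Ω) 0 (by simpa using hε.le))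
  have hmove : Continuous fun p : Ω × E d => (α p.1 p.2, -p.2 +ᵥ p.1) :=
    H.continuous.prodMk (by fun_prop)
  obtain ⟨η, hη, hmove_η⟩ := Metric.uniformContinuousOn_iff.1
    (((isCompact_univ (X := Ω)).prod
      (isCompact_closedBall (0 : E d) (C + 1))).uniformContinuousOn_of_continuous
        hmove.continuousOn) ε hε
  obtain ⟨δ, hδ, hδη, hδC⟩ := exists_near_scale (lt_min hη one_pos) hC0
  have hδη' : δ < η := by linarith [min_le_left η 1]
  have hδ1 : δ ≤ 1 := by linarith [min_le_right η 1]
  have hCδ : C < δ⁻¹ := by linarith [inv_pos.2 (lt_min hη one_pos)]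
  refine ⟨δ, hδ, ?_⟩
  rintro S S' hSS' hnear _ ⟨_, ⟨p, hp, rfl⟩, rfl⟩ hαp
  have hpC : ‖p.1‖ ≤ C := by simpa [H.leftInverse S p.1] using hC S _ hαp.le
  obtain ⟨q, hq, hpq⟩ := hnear.1 p hp (hpC.trans_lt hCδ)
  have hpq1 : dist p.1 q.1 < δ := (le_max_left _ _).trans_lt hpq
  have hqC : ‖q.1‖ ≤ C + 1 := by
    linarith [norm_le_norm_add_norm_sub' q.1 p.1, dist_comm p.1 q.1, dist_eq_norm q.1 p.1]
  refine ⟨_, mem_image_of_mem _ (mem_image_of_mem _ hq), ?_⟩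
  exact hmove_η (S, p.1) ⟨mem_univ _, mem_closedBall_zero_iff.2 (by linarith)⟩
    (S', q.1) ⟨mem_univ _, mem_closedBall_zero_iff.2 hqC⟩
    (max_lt (hSS'.trans hδη') (hpq1.trans hδη'))

theorem continuous_deform (H : IsInvertibleCocycle α β) : Continuous H.deform := by
  refine continuous_iff_continuousAt.2 fun T =>
    (nhds_basis_uniformity hasBasis_uniformity).tendsto_right_iff.2 fun ε hε => ?_
  obtain ⟨δ, hδ, hdeform⟩ := H.exists_forall_exists_mem_deformGraph_dist_lt hε
  filter_upwards [Metric.ball_mem_nhds T hδ, continuous_subtype_val.continuousAt.eventually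
    ((nhds_basis_uniformity hasBasis_uniformity).mem_of_mem hδ)] with S hST hnear
  refine ⟨hdeform S T hST hnear, fun q hq hqε => ?_⟩
  obtain ⟨p, hp, hqp⟩ := hdeform T S (Metric.mem_ball'.1 hST) (near_symm hnear) q hq hqε
  exact ⟨p, hp, (dist_comm p q).trans_lt hqp⟩

theorem hull_deform (H : IsInvertibleCocycle α β) (T : Ω) :
    hull (H.deform T) = range H.deform := by
  rw [hull, ← H.intertwines_deform.image_orbit (H.rightInverse T).surjective, ← image_univ,
    ← (AddAction.dense_orbit (E d) T).closure_eq]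
  exact (image_closure_of_isCompact isClosed_closure.isCompact
    H.continuous_deform.continuousOn).symm

/-- The tiling space made of the deformations of all the elements of `Ω`. -/
noncomputable def deformSpace (H : IsInvertibleCocycle α β) : TilingSpace.{u} d where
  Label := Ω
  carrier := range H.deform
  exists_hull := ⟨_, (H.hull_deform (Classical.arbitrary Ω)).symm⟩
  minimal := by
    rintro _ ⟨T, rfl⟩
    exact H.hull_deform T
  aperiodic := by
    rintro _ ⟨T, rfl⟩ x hx
    obtain ⟨y, hy⟩ := (H.rightInverse T).surjective (-x)
    have hyT : -y +ᵥ T = T := H.deform_injective (by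
      rw [H.intertwines_deform, hy, neg_neg, hx])
    have hy0 : -y = 0 := Ω.aperiodic T.1 T.2 _ (congrArg Subtype.val hyT)
    rwa [neg_eq_zero.1 hy0, H.map_zero, eq_comm, neg_eq_zero] at hy

/-- The deformation as a homeomorphism from `Ω` onto the tiling space of the deformed sets. -/
noncomputable def deformHomeo (H : IsInvertibleCocycle α β) : Ω ≃ₜ H.deformSpace :=
  Continuous.homeoOfEquivCompactToT2 (f := Equiv.ofInjective H.deform H.deform_injective)
    (H.continuous_deform.subtype_mk _)

theorem intertwines_deformHomeo (H : IsInvertibleCocycle α β) : Intertwines H.deformHomeo α :=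
  fun T x => Subtype.ext (H.intertwines_deform T x)

theorem isShapeChange (H : IsInvertibleCocycle α β) :
    IsShapeChange Ω H.deformSpace H.deformHomeo α where
  cocycle := H.toIsCocycle
  isHomeomorph := H.isHomeomorph
  map_sub := H.intertwines_deformHomeo
  points_eq := H.points_deform
  label := by
    have : Nonempty Ω.Label := by
      obtain ⟨_, p, -, -⟩ := (Classical.arbitrary Ω).1.points_nonempty
      exact ⟨p.2⟩
    -- The new label of `x` is `T - x`, and the old one is the label of `0` in `T - x`.
    choose! ρ hρ using fun (S : Ω) (hS : ∃ l, ((0 : E d), l) ∈ S.1.graph) => hS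
    refine ⟨ρ, ?_⟩
    rintro T x l _ hx ⟨y, -, hy⟩
    obtain rfl : y = x := (H.leftInverse T).injective (congrArg Prod.fst hy)
    obtain rfl := congrArg Prod.snd hy
    have h0 : ((0 : E d), l) ∈ (-y +ᵥ T : Ω).1.graph := mem_vadd.2 (by simpa using hx)
    exact (-y +ᵥ T : Ω).1.functional _ (hρ _ ⟨l, h0⟩) _ h0 rfl

end IsInvertibleCocycle

theorem image_symm_orbit {h : Ω ≃ₜ Ω'}
    (hh : ∀ T : Ω, h '' AddAction.orbit (E d) T = AddAction.orbit (E d) (h T)) (T : Ω') :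
    h.symm '' AddAction.orbit (E d) T = AddAction.orbit (E d) (h.symm T) := by
  rw [h.image_symm, ← h.preimage_image (AddAction.orbit (E d) (h.symm T)), hh, h.apply_symm_apply]

theorem equivalence_orbitEquivalent : Equivalence (OrbitEquivalent (d := d)) where
  refl _ := ⟨Homeomorph.refl _, fun _ => image_id _⟩
  symm := fun ⟨h, hh⟩ => ⟨h.symm, image_symm_orbit hh⟩
  trans := fun ⟨h, hh⟩ ⟨g, hg⟩ => ⟨h.trans g, fun T =>
    (image_comp g h _).trans ((congrArg (g '' ·) (hh T)).trans (hg (h T)))⟩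

theorem Conjugate.orbitEquivalent : Conjugate Ω Ω' → OrbitEquivalent Ω Ω' :=
  fun ⟨h, hh⟩ => ⟨h, fun T =>
    Intertwines.image_orbit (α := fun _ => id) (fun T x => hh T (-x)) (T := T)
      Function.surjective_id⟩

theorem ShapeChange.orbitEquivalent : ShapeChange Ω Ω' → OrbitEquivalent Ω Ω' :=
  fun ⟨h, _, hα⟩ => ⟨h, fun T => Intertwines.image_orbit hα.map_sub (hα.isHomeomorph T).surjective⟩

theorem Conjugate.of_intertwines {h : Ω ≃ₜ Ω'} {g : Ω ≃ₜ Ω''} (hh : Intertwines h α)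
    (hg : Intertwines g α) (hα : ∀ T, Function.Surjective (α T)) : Conjugate Ω' Ω'' := by
  refine ⟨h.symm.trans g, fun T x => ?_⟩
  obtain ⟨T, rfl⟩ := h.surjective T
  obtain ⟨y, hy⟩ := hα T (-x)
  have hx : x = -α T y := by rw [hy, neg_neg]
  rw [Homeomorph.trans_apply, Homeomorph.trans_apply, hx, ← hh, h.symm_apply_apply,
    h.symm_apply_apply, hg]

theorem OrbitEquivalent.exists_isInvertibleCocycle :
    OrbitEquivalent Ω Ω' → ∃ (h : Ω ≃ₜ Ω') (α β : Ω → E d → E d),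
      Intertwines h α ∧ IsInvertibleCocycle α β := by
  rintro ⟨h, hh⟩
  obtain ⟨α, hα⟩ := exists_intertwines (V := E d) (W := E d) fun T => (hh T).subset
  obtain ⟨β, hβ⟩ :=
    exists_intertwines (V := E d) (W := E d) fun T => (image_symm_orbit hh T).subset
  have hβc := hβ.continuous_cocycle h.symm.continuous
  exact ⟨h, α, fun T => β (h T), hα,
    { continuous := hα.continuous_cocycle h.continuous
      add := hα.cocycle_add
      continuous_inv := hβc.comp (h.continuous.prodMap continuous_id)
      leftInverse := hα.cocycle_leftInverse hβ h.symm_apply_apply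
      rightInverse := hα.cocycle_rightInverse hβ h.symm_apply_apply h.apply_symm_apply }⟩

theorem OrbitEquivalent.exists_shapeChange_conjugate (hΩ : OrbitEquivalent Ω Ω') :
    ∃ Ω'' : TilingSpace.{u} d, ShapeChange Ω Ω'' ∧ Conjugate Ω' Ω'' := by
  obtain ⟨h, α, β, hα, H⟩ := hΩ.exists_isInvertibleCocycle
  exact ⟨H.deformSpace, ⟨_, _, H.isShapeChange⟩,
    .of_intertwines hα H.intertwines_deformHomeo fun T => (H.rightInverse T).surjective⟩

theorem UniquelyErgodic.of_conjugate (hΩ : Ω.UniquelyErgodic) (hc : Conjugate Ω Ω') :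
    Ω'.UniquelyErgodic := by
  obtain ⟨h, hh⟩ := hc
  obtain ⟨μ, ⟨_, _⟩, huniq⟩ := hΩ
  have hm : Measurable h := h.continuous.measurable
  have hm' : Measurable h.symm := h.symm.continuous.measurable
  have hh' : ∀ (x : E d) (T : Ω'), h.symm (x +ᵥ T) = x +ᵥ h.symm T := fun x T => by
    rw [h.symm_apply_eq, hh, h.apply_symm_apply]
  refine ⟨μ.map h, ⟨Measure.isProbabilityMeasure_map hm.aemeasurable,
    vaddInvariantMeasure_map μ h (fun x T => hh T x) hm⟩, fun ν ⟨_, _⟩ => ?_⟩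
  rw [← huniq (ν.map h.symm) ⟨Measure.isProbabilityMeasure_map hm'.aemeasurable,
    vaddInvariantMeasure_map ν h.symm hh' hm'⟩, Measure.map_map hm hm', h.self_comp_symm,
    Measure.map_id]

end TilingSpace

end TilingShape

open TilingShape TilingSpace in
theorem mainTheorem5_general {d : ℕ} {P : TilingSpace.{u} d → Prop}
    (hP : ∀ A B, Conjugate A B → P A → P B) (Ω Ω' : {Ω : TilingSpace.{u} d // P Ω}) :
    OrbitEquivalent Ω.1 Ω'.1 ↔
      Relation.EqvGen (fun A B : {Ω : TilingSpace.{u} d // P Ω} =>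
        Conjugate A.1 B.1 ∨ ShapeChange A.1 B.1) Ω Ω' := by
  refine ⟨fun h => ?_, fun h => ?_⟩
  · obtain ⟨Ω₁, hshape, hconj⟩ := h.exists_shapeChange_conjugate
    let Ω₁' : {Ω : TilingSpace.{u} d // P Ω} := ⟨Ω₁, hP _ _ hconj Ω'.2⟩
    exact .trans _ Ω₁' _ (.rel _ _ (.inr hshape)) (.symm _ _ (.rel _ _ (.inl hconj)))
  · refine (equivalence_orbitEquivalent.comap Subtype.val).eqvGen_iff.1 (h.mono fun A B hAB => ?_)
    exact hAB.elim (·.orbitEquivalent) (·.orbitEquivalent)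

theorem mainTheorem5 (d : ℕ) (Ω Ω' : TilingShape.UETilingSpace.{u} d) :
    TilingShape.TilingSpace.OrbitEquivalent Ω.1 Ω'.1 ↔
      Relation.EqvGen
        (fun A B : TilingShape.UETilingSpace.{u} d =>
          TilingShape.TilingSpace.Conjugate A.1 B.1 ∨ TilingShape.TilingSpace.ShapeChange A.1 B.1)
        Ω Ω' :=
  mainTheorem5_general (fun _ _ hconj hA => hA.of_conjugate hconj) Ω Ω'
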